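/- Let $\Sigma$ be a finite alphabet with at least two elements, and let $\mathrm{Pr}$ be the uniform probability measure on $\Sigma^\omega$, i.e. the probability measure on the $\sigma$-algebra generated by the cylinder sets $\mathrm{Cyl}(x)$ (the set of infinite words with prefix $x$), $x \in \Sigma^*$, with $\mathrm{Pr}(\mathrm{Cyl}(a_1\ldots a_n)) = 1/|\Sigma|^n$. Let $\mathcal{U} = (Q,\Sigma,\delta,Q_0,F)$ be a nondeterministic Büchi automaton with finite state set $Q$, transition function $\delta : Q\times\Sigma \to 2^Q$, initial states $Q_0 \subseteq Q$ and final states $F \subseteq Q$. A run for $w = a_1a_2a_3\ldots \in \Sigma^\omega$ is a sequence $q_0q_1q_2\ldots \in Q^\omega$ with $q_0\in Q_0$ and $q_{i+1}\in\delta(q_i,a_{i+1})$ for all $i \ge 0$; it is accepting if $q_i\in F$ for infinitely many $i$. The language $\mathcal{L}_\omega(\mathcal{U})$ is the set of $w \in \Sigma^\omega$ that have an accepting run. Suppose that - $\mathcal{U}$ is unambiguous, i.e. each $w\in\Sigma^\omega$ has at most one accepting run; for $w\in \mathcal{L}_\omega(\mathcal{U})$ let $\mathrm{accrun}(w)$ be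 its unique accepting run; - $\mathcal{U}$ is strongly connected, i.e. for all $p,q\in Q$ there is a finite word $x \in \Sigma^*$ with $q\in\delta(p,x)$, where $\delta$ is extended to finite words in the usual way; - $F\neq\varnothing$. For $\rho \in Q^\omega$ let $\mathrm{inf}(\rho)$ be the set of states that occur infinitely often in $\rho$. Then the sets $\mathcal{L}_\omega(\mathcal{U})$ and $\{w\in\mathcal{L}_\omega(\mathcal{U}) : \mathrm{inf}(\mathrm{accrun}(w)) = Q\}$ are measurable and $$\mathrm{Pr}\bigl\{w\in\mathcal{L}_\omega(\mathcal{U}) : \mathrm{inf}(\mathrm{accrun}(w)) = Q\bigr\} = \mathrm{Pr}\bigl(\mathcal{L}_\omega(\mathcal{U})\bigr).$$ -/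

import Mathlib

open MeasureTheory

/-- A nondeterministic Büchi automaton `(Q, Σ, δ, Q₀, F)` with alphabet `A` (for `Σ`) and state
type `Q`. Finiteness of `A` and `Q` is imposed by type classes where the automaton is used. -/
structure NBA (A Q : Type*) where
  /-- the transition function `δ : Q × Σ → 2^Q` -/
  delta : Q → A → Set Q
  /-- the set `Q₀` of initial states -/
  init : Set Q
  /-- the set `F` of accepting (final) states -/
  final : Set Q

namespace NBA

variable {A Q : Type*}

/-- The extension of the transition function to sets of states and finite words. -/
def deltaStar (U : NBA A Q) : Set Q → List A → Set Q
  | R, [] => R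
  | R, a :: x => U.deltaStar (⋃ q ∈ R, U.delta q a) x

/-- Every state is reachable from every state by some finite word. -/
def StronglyConnected (U : NBA A Q) : Prop :=
  ∀ p q : Q, ∃ x : List A, q ∈ U.deltaStar {p} x

/-- `ρ = q₀ q₁ q₂ …` is a run for the infinite word `w`; the letters of `w` are
`w 0, w 1, w 2, …`, and `w i` is the letter read between `ρ i` and `ρ (i + 1)`. -/
def IsRun (U : NBA A Q) (w : ℕ → A) (ρ : ℕ → Q) : Prop :=
  ρ 0 ∈ U.init ∧ ∀ i, ρ (i + 1) ∈ U.delta (ρ i) (w i)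

/-- A run is accepting if it is in `F` at infinitely many positions. -/
def IsAcceptingRun (U : NBA A Q) (w : ℕ → A) (ρ : ℕ → Q) : Prop :=
  U.IsRun w ρ ∧ {i : ℕ | ρ i ∈ U.final}.Infinite

/-- The language of the infinite words that have at least one accepting run. -/
def language (U : NBA A Q) : Set (ℕ → A) :=
  {w | ∃ ρ, U.IsAcceptingRun w ρ}

/-- Each infinite word has at most one accepting run. -/
def Unambiguous (U : NBA A Q) : Prop :=
  ∀ (w : ℕ → A) (ρ ρ' : ℕ → Q), U.IsAcceptingRun w ρ → U.IsAcceptingRun w ρ' → ρ = ρ'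

/-- The accepting run of an accepted word; in an unambiguous automaton it is the unique one
(see `accRun_spec` and `eq_accRun`). -/
noncomputable def accRun (U : NBA A Q) (w : ℕ → A) (hw : w ∈ U.language) : ℕ → Q :=
  Classical.choose hw

theorem accRun_spec (U : NBA A Q) (w : ℕ → A) (hw : w ∈ U.language) :
    U.IsAcceptingRun w (U.accRun w hw) :=
  Classical.choose_spec hw

theorem eq_accRun (U : NBA A Q) (hU : U.Unambiguous) (w : ℕ → A) (hw : w ∈ U.language)
    (ρ : ℕ → Q) (hρ : U.IsAcceptingRun w ρ) : ρ = U.accRun w hw :=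
  hU w _ _ hρ (U.accRun_spec w hw)

end NBA

/-- The set of states that appear infinitely often in a sequence of states. -/
def infStates {Q : Type*} (ρ : ℕ → Q) : Set Q :=
  {q | {i : ℕ | ρ i = q}.Infinite}

/-- The uniform probability measure on infinite words: the letters are independent and uniformly
distributed. The `σ`-algebra on `ℕ → A` is the product one, which is the one generated by the
cylinder sets when all subsets of the finite alphabet `A` are measurable. -/
noncomputable def wordMeasure (A : Type*) [Fintype A] [Nonempty A] [MeasurableSpace A] :
    Measure (ℕ → A) :=
  Measure.infinitePi fun _ : ℕ => (PMF.uniformOfFintype A).toMeasure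

/-- The cylinder set of the finite word `x`. -/
def cylinderSet {A : Type*} (x : List A) : Set (ℕ → A) :=
  {w | ∀ i : Fin x.length, w i = x.get i}

/-- The cylinder set of a finite word of length `n` has measure `1 / |A| ^ n`. -/
theorem wordMeasure_cylinderSet {A : Type*} [Fintype A] [Nonempty A] [MeasurableSpace A]
    [DiscreteMeasurableSpace A] (x : List A) :
    wordMeasure A (cylinderSet x) = 1 / (Fintype.card A : ENNReal) ^ x.length := by
  classical
  have hx : cylinderSet x = Set.pi (Finset.range x.length : Set ℕ)
      (fun i => if h : i < x.length then {x.get ⟨i, h⟩} else Set.univ) := by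
    ext w
    simp only [cylinderSet, Set.mem_ofPred_eq, Set.mem_pi, Finset.coe_range, Set.mem_Iio]
    constructor
    · intro h i hi
      simpa [hi] using h ⟨i, hi⟩
    · intro h i
      simpa using h i i.2
  rw [hx, wordMeasure, Measure.infinitePi_pi _ (fun i _ => MeasurableSet.of_discrete)]
  have : ∀ i ∈ Finset.range x.length, (PMF.uniformOfFintype A).toMeasure
      (if h : i < x.length then {x.get ⟨i, h⟩} else Set.univ)
        = (Fintype.card A : ENNReal)⁻¹ := by
    intro i hi
    have hi' : i < x.length := Finset.mem_range.1 hi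
    rw [dif_pos hi', PMF.toMeasure_apply_singleton _ _ (MeasurableSet.of_discrete)]
    simp
  rw [Finset.prod_congr rfl this]
  simp [ENNReal.inv_pow]

/-! Fix a state `q`. Let g(p) be the probability that a word has an accepting run from `p`, and f(p)
the probability that it has one avoiding `q`. Split words by their first transition. By unambiguity
different transitions out of `p` give disjoint sets of words, so the transition sum of g is at most
|A| g(p); a union bound gives the opposite inequality for f.

Since f ≤ g and f(q) = 0, a maximum principle for f/g, `StronglyConnected.eq_zero_of_le_succSum`,
forces f = 0. An accepting run visiting `q` only finitely often has a tail avoiding `q`, so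
countably many null sets cover the exceptional words.

Measurability comes from the Lusin–Souslin theorem: by unambiguity, the projection from pairs (word,
accepting run) to words is injective. -/

open scoped Classical in
/-- The sum of `f` over all outgoing transitions of the state `p`. -/
noncomputable def NBA.succSum {A Q : Type*} [Fintype A] [Fintype Q] (U : NBA A Q)
    (f : Q → ℝ) (p : Q) : ℝ :=
  ∑ x : A × Q with x.2 ∈ U.delta p x.1, f x.2

/-! ### Prepending and dropping letters -/

/-- The infinite word `a w`. -/
def consWord {A : Type*} (a : A) (w : ℕ → A) : ℕ → A
  | 0 => a
  | n + 1 => w n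

/-- The infinite word `w` without its first `n` letters. -/
def dropWord {A : Type*} (n : ℕ) (w : ℕ → A) : ℕ → A := fun i => w (i + n)

theorem consWord_head_dropWord {A : Type*} (w : ℕ → A) :
    consWord (w 0) (dropWord 1 w) = w := by
  funext n
  cases n <;> rfl

theorem measurable_dropWord {A : Type*} [MeasurableSpace A] (n : ℕ) :
    Measurable (dropWord n : (ℕ → A) → (ℕ → A)) :=
  measurable_pi_lambda _ fun i => measurable_pi_apply (i + n)

theorem measurable_uncurry_consWord {A : Type*} [MeasurableSpace A] :
    Measurable (fun x : A × (ℕ → A) => consWord x.1 x.2) := by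
  refine measurable_pi_lambda _ fun i => ?_
  cases i with
  | zero => exact measurable_fst
  | succ n => exact (measurable_pi_apply n).comp measurable_snd

/-- The words with first letter `a` whose remainder lies in `S`. -/
def consSet {A : Type*} (a : A) (S : Set (ℕ → A)) : Set (ℕ → A) :=
  {w | w 0 = a ∧ dropWord 1 w ∈ S}

theorem measurableSet_consSet {A : Type*} [Finite A] [MeasurableSpace A]
    [DiscreteMeasurableSpace A] (a : A) {S : Set (ℕ → A)} (hS : MeasurableSet S) :
    MeasurableSet (consSet a S) :=
  (measurableSet_eq_fun (measurable_pi_apply 0) measurable_const).inter (measurable_dropWord 1 hS)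

/-! ### The uniform measure under prepending and shifting -/

section Measure

variable {A : Type*} [Fintype A] [Nonempty A] [MeasurableSpace A]

instance : IsProbabilityMeasure (wordMeasure A) := by
  unfold wordMeasure
  infer_instance

/-- The letters are independent and identically distributed, so a fresh uniform letter in front
changes nothing. This is the source of the factor 1/|A| per letter. -/
theorem map_consWord_prod :
    ((PMF.uniformOfFintype A).toMeasure.prod (wordMeasure A)).map
      (fun x => consWord x.1 x.2) = wordMeasure A := by
  classical
  refine Measure.eq_infinitePi _ fun s t ht => ?_
  obtain ⟨n, hn⟩ := s.exists_nat_subset_range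
  set P : Measure A := (PMF.uniformOfFintype A).toMeasure
  -- Padding with `Set.univ` turns the index set into an initial segment that contains 0, so the
  -- first coordinate can be split off.
  set t' : ℕ → Set A := fun i => if i ∈ s then t i else Set.univ with ht'
  have hmeas : ∀ i, MeasurableSet (t' i) := fun i => by
    by_cases h : i ∈ s <;> simp [t', h, ht]
  have hsub : s ⊆ Finset.range (n + 1) :=
    hn.trans (Finset.range_subset_range.2 n.le_succ)
  have hpi : Set.pi (s : Set ℕ) t = Set.pi (Finset.range (n + 1) : Set ℕ) t' := by
    ext w
    simp only [Set.mem_pi, Finset.mem_coe, t']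
    constructor
    · intro h i _
      by_cases hi : i ∈ s
      · simpa [hi] using h i hi
      · simp [hi]
    · intro h i hi
      simpa [hi] using h i (hsub hi)
  have hprod : ∏ i ∈ s, P (t i) = ∏ i ∈ Finset.range (n + 1), P (t' i) := by
    rw [← Finset.prod_subset hsub (f := fun i => P (t' i))
      (fun i _ hi => by simp [t', hi])]
    exact Finset.prod_congr rfl fun i hi => by simp [t', hi]
  have hpre : (fun x : A × (ℕ → A) => consWord x.1 x.2) ⁻¹'
      Set.pi (Finset.range (n + 1) : Set ℕ) t' =
      t' 0 ×ˢ Set.pi (Finset.range n : Set ℕ) (fun i => t' (i + 1)) := by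
    ext ⟨a, w⟩
    simp only [Set.mem_preimage, Set.mem_pi, Finset.mem_coe, Finset.mem_range, Set.mem_prod]
    constructor
    · intro h
      exact ⟨h 0 n.succ_pos, fun i hi => h (i + 1) (Nat.succ_lt_succ hi)⟩
    · rintro ⟨h0, h1⟩ i hi
      cases i with
      | zero => exact h0
      | succ i => exact h1 i (Nat.lt_of_succ_lt_succ hi)
  rw [hprod, hpi, Measure.map_apply measurable_uncurry_consWord
    (MeasurableSet.pi (Set.to_countable _) fun i _ => hmeas i), hpre, Measure.prod_prod,
    wordMeasure, Measure.infinitePi_pi _ (fun i _ => hmeas (i + 1)), Finset.prod_range_succ',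
    mul_comm]

variable [DiscreteMeasurableSpace A]

theorem wordMeasure_consSet (a : A) {S : Set (ℕ → A)} (hS : MeasurableSet S) :
    wordMeasure A (consSet a S) = (Fintype.card A : ENNReal)⁻¹ * wordMeasure A S := by
  conv_lhs => rw [← map_consWord_prod]
  have hpre : (fun x : A × (ℕ → A) => consWord x.1 x.2) ⁻¹' consSet a S = {a} ×ˢ S := by
    ext ⟨b, w⟩
    rfl
  rw [Measure.map_apply measurable_uncurry_consWord (measurableSet_consSet a hS), hpre,
    Measure.prod_prod, PMF.toMeasure_apply_singleton _ _ (MeasurableSet.singleton a)]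
  simp

theorem card_mul_measureReal_consSet (a : A) {S : Set (ℕ → A)} (hS : MeasurableSet S) :
    (Fintype.card A : ℝ) * (wordMeasure A).real (consSet a S) = (wordMeasure A).real S := by
  have hA : (Fintype.card A : ℝ) ≠ 0 := Nat.cast_ne_zero.2 Fintype.card_ne_zero
  rw [measureReal_def, wordMeasure_consSet a hS, ENNReal.toReal_mul, ENNReal.toReal_inv,
    ENNReal.toReal_natCast, mul_inv_cancel_left₀ hA, measureReal_def]

/-- Splitting by the first letter covers each preimage by finitely many scaled copies of the
previous one. This transfers null sets of tails to whole words. -/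
theorem wordMeasure_preimage_dropWord_eq_zero {S : Set (ℕ → A)} (hS : MeasurableSet S)
    (h0 : wordMeasure A S = 0) (n : ℕ) : wordMeasure A (dropWord n ⁻¹' S) = 0 := by
  induction n with
  | zero => exact h0
  | succ n ih =>
    have hsub : (dropWord (n + 1) ⁻¹' S : Set (ℕ → A)) ⊆
        ⋃ a : A, consSet a (dropWord n ⁻¹' S) := by
      intro w hw
      refine Set.mem_iUnion.2 ⟨w 0, rfl, ?_⟩
      have : dropWord n (dropWord 1 w) = dropWord (n + 1) w := by
        funext i
        simp [dropWord, add_assoc]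
      simpa [this] using hw
    refine measure_mono_null hsub (measure_iUnion_null fun a => ?_)
    rw [wordMeasure_consSet a (measurable_dropWord n hS), ih, mul_zero]

end Measure

theorem measurableSet_setOf_forall {X ι : Type*} [MeasurableSpace X] [Countable ι]
    {p : ι → X → Prop} (hp : ∀ i, MeasurableSet {x | p i x}) :
    MeasurableSet {x | ∀ i, p i x} := by
  rw [Set.ofPred_forall]
  exact MeasurableSet.iInter hp

/-! ### Propagation of properties along transitions -/

namespace NBA

variable {A Q : Type*} (U : NBA A Q)

/-- A property of states that is inherited by successors and holds on `R` holds on every set of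
states reached from `R`. -/
theorem forall_mem_deltaStar {P : Q → Prop}
    (hP : ∀ p a p', p' ∈ U.delta p a → P p → P p') (x : List A) :
    ∀ R : Set Q, (∀ p ∈ R, P p) → ∀ p ∈ U.deltaStar R x, P p := by
  induction x with
  | nil => exact fun R hR => hR
  | cons a x ih =>
    intro R hR
    refine ih _ fun p' hp' => ?_
    obtain ⟨p, hp, hpp'⟩ := Set.mem_iUnion₂.1 hp'
    exact hP p a p' hpp' (hR p hp)

variable {U}

theorem StronglyConnected.forall_of_succ (hconn : U.StronglyConnected) {P : Q → Prop}
    (hP : ∀ p a p', p' ∈ U.delta p a → P p → P p') {p : Q} (hp : P p) (q : Q) : P q := by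
  obtain ⟨x, hx⟩ := hconn p q
  exact U.forall_mem_deltaStar hP x {p} (fun r hr => by rwa [Set.mem_singleton_iff.1 hr]) q hx

theorem StronglyConnected.forall_of_pred (hconn : U.StronglyConnected) {P : Q → Prop}
    (hP : ∀ p a p', p' ∈ U.delta p a → P p' → P p) {p : Q} (hp : P p) (q : Q) : P q := by
  by_contra hq
  exact hconn.forall_of_succ (P := fun r => ¬ P r)
    (fun r a r' hr hnr hr' => hnr (hP r a r' hr hr')) hq p hp

/-! ### The maximum principle -/

section SuccSum

variable [Fintype A] [Fintype Q]

theorem le_succSum {f : Q → ℝ} (hf : ∀ p, 0 ≤ f p) {p p' : Q} {a : A}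
    (h : p' ∈ U.delta p a) : f p' ≤ U.succSum f p := by
  classical
  exact Finset.single_le_sum (f := fun x : A × Q => f x.2) (fun x _ => hf x.2)
    (Finset.mem_filter.2 ⟨Finset.mem_univ (a, p'), h⟩)

theorem succSum_const_mul_sub (c : ℝ) (f g : Q → ℝ) (p : Q) :
    U.succSum (fun r => c * g r - f r) p = c * U.succSum g p - U.succSum f p := by
  simp only [succSum, Finset.sum_sub_distrib, Finset.mul_sum]

/-- In a strongly connected automaton, a nonnegative function that is subharmonic for the transition
sums, dominated by a superharmonic one, and zero in some state, is zero. -/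
theorem StronglyConnected.eq_zero_of_le_succSum (hconn : U.StronglyConnected) {k : ℝ}
    (hk : 0 < k) {f g : Q → ℝ} (hf : ∀ p, 0 ≤ f p) (hfg : ∀ p, f p ≤ g p)
    (hfT : ∀ p, k * f p ≤ U.succSum f p) (hgT : ∀ p, U.succSum g p ≤ k * g p)
    {q : Q} (hq : f q = 0) (p : Q) : f p = 0 := by
  by_contra hp
  have hfp : 0 < f p := lt_of_le_of_ne (hf p) (Ne.symm hp)
  have hg0 : ∀ r, 0 ≤ g r := fun r => (hf r).trans (hfg r)
  -- Superharmonicity carries positivity of g backwards along transitions, so the quotients f/g make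
  -- sense everywhere.
  have hg : ∀ r, 0 < g r := hconn.forall_of_pred
    (fun r a r' h hr' => pos_of_mul_pos_right
      (hr'.trans_le ((le_succSum hg0 h).trans (hgT r))) hk.le) (hfp.trans_le (hfg p))
  have : Nonempty Q := ⟨p⟩
  obtain ⟨m, hm⟩ := Finite.exists_max fun r => f r / g r
  set c := f m / g m with hc
  have hcpos : 0 < c := (div_pos hfp (hg p)).trans_le (hm p)
  have h0 : ∀ r, 0 ≤ c * g r - f r := fun r =>
    sub_nonneg.2 ((div_le_iff₀ (hg r)).1 (hm r))
  have hT : ∀ r, U.succSum (fun r => c * g r - f r) r ≤ k * (c * g r - f r) := fun r => by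
    rw [succSum_const_mul_sub]
    have := mul_le_mul_of_nonneg_left (hgT r) hcpos.le
    linarith [hfT r]
  -- The function c g - f is nonnegative, superharmonic and zero at the maximizer `m`; its zeros
  -- therefore pass to successors, and so to `q`.
  have hzero : c * g q - f q = 0 := hconn.forall_of_succ (P := fun r => c * g r - f r = 0)
    (fun r a r' h hr => le_antisymm
      (by simpa only [hr, mul_zero] using (le_succSum h0 h).trans (hT r)) (h0 r'))
    (p := m) (by rw [hc, div_mul_cancel₀ _ (hg m).ne', sub_self]) q
  rw [hq, sub_zero] at hzero
  exact (mul_pos hcpos (hg q)).ne' hzero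

end SuccSum

/-! ### Changing the initial state -/

/-- The automaton with `p` as its only initial state. -/
def startAt (U : NBA A Q) (p : Q) : NBA A Q :=
  { U with init := {p} }

/-- The words that have an accepting run lying in `T`. -/
def languageIn (U : NBA A Q) (T : Set (ℕ → Q)) : Set (ℕ → A) :=
  {w | ∃ ρ, U.IsAcceptingRun w ρ ∧ ρ ∈ T}

theorem languageIn_univ : U.languageIn Set.univ = U.language := by
  simp [languageIn, language]

theorem IsAcceptingRun.startAt_drop {w : ℕ → A} {ρ : ℕ → Q} (h : U.IsAcceptingRun w ρ) (n : ℕ) :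
    (U.startAt (ρ n)).IsAcceptingRun (dropWord n w) (dropWord n ρ) := by
  refine ⟨⟨?_, fun i => ?_⟩, ?_⟩
  · simp [startAt, dropWord]
  · have := h.1.2 (i + n)
    rwa [add_right_comm] at this
  · refine Set.infinite_of_not_bddAbove fun ⟨b, hb⟩ => ?_
    obtain ⟨i, hi, hbi⟩ := h.2.exists_gt (b + n)
    have hmem : i - n ∈ {i | dropWord n ρ i ∈ (U.startAt (ρ n)).final} := by
      have hin : i - n + n = i := by omega
      simpa [dropWord, hin, startAt] using hi
    have := hb hmem
    omega

theorem IsAcceptingRun.cons {w : ℕ → A} {ρ : ℕ → Q} {p p' : Q} {a : A}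
    (hp : p' ∈ U.delta p a) (h : (U.startAt p').IsAcceptingRun w ρ) :
    (U.startAt p).IsAcceptingRun (consWord a w) (consWord p ρ) := by
  refine ⟨⟨rfl, fun i => ?_⟩, ?_⟩
  · cases i with
    | zero =>
      have h0 : ρ 0 = p' := h.1.1
      simpa [consWord, startAt, h0] using hp
    | succ i => exact h.1.2 i
  · refine Set.Infinite.mono ?_ (h.2.image (Nat.succ_injective.injOn))
    rintro _ ⟨i, hi, rfl⟩
    exact hi

theorem consWord_right_injective (p : Q) : Function.Injective (consWord p) := fun _ _ h =>
  funext fun i => congrFun h (i + 1)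

theorem Unambiguous.startAt (hU : U.Unambiguous) {p : Q} (hp : p ∈ U.init) :
    (U.startAt p).Unambiguous := by
  have key : ∀ {w ρ}, (U.startAt p).IsAcceptingRun w ρ → U.IsAcceptingRun w ρ :=
    fun {w ρ} h => ⟨⟨by rwa [show ρ 0 = p from h.1.1], h.1.2⟩, h.2⟩
  exact fun w ρ ρ' h h' => hU w ρ ρ' (key h) (key h')

/-- Distinct accepting runs from `p'` on one word remain distinct after the same transition is
prepended to both. -/
theorem Unambiguous.startAt_succ {p p' : Q} {a : A} (hp' : p' ∈ U.delta p a)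
    (hp : (U.startAt p).Unambiguous) : (U.startAt p').Unambiguous := fun _ _ _ h h' =>
  consWord_right_injective p (hp _ _ _ (h.cons hp') (h'.cons hp'))

theorem Unambiguous.forall_startAt (hU : U.Unambiguous) (hconn : U.StronglyConnected)
    {p : Q} (hp : p ∈ U.init) (q : Q) : (U.startAt q).Unambiguous :=
  hconn.forall_of_succ (P := fun r => (U.startAt r).Unambiguous)
    (fun _ _ _ h hr => hr.startAt_succ h) (hU.startAt hp) q

theorem measurableSet_infinite_preimage {X : Type*} [MeasurableSpace X] {S : Set X}
    (hS : MeasurableSet S) : MeasurableSet {ρ : ℕ → X | {i | ρ i ∈ S}.Infinite} := by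
  have : {ρ : ℕ → X | {i | ρ i ∈ S}.Infinite} = ⋂ n : ℕ, ⋃ i : ℕ, ⋃ _ : n < i, {ρ | ρ i ∈ S} := by
    ext ρ
    simp only [Set.mem_iInter, Set.mem_iUnion, Set.mem_ofPred_eq]
    constructor
    · intro h n
      obtain ⟨i, hi, hni⟩ := h.exists_gt n
      exact ⟨i, hni, hi⟩
    · intro h
      refine Set.infinite_of_forall_exists_gt fun n => ?_
      obtain ⟨i, hni, hi⟩ := h n
      exact ⟨i, hi, hni⟩
  rw [this]
  exact MeasurableSet.iInter fun n => MeasurableSet.iUnion fun i => MeasurableSet.iUnion fun _ =>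
    measurable_pi_apply i hS

/-! ### Measurability via injective Borel images -/

section Measurability

variable [Finite A] [MeasurableSpace A] [DiscreteMeasurableSpace A]
  [Finite Q] [MeasurableSpace Q] [DiscreteMeasurableSpace Q]

theorem measurableSet_isAcceptingRun (U : NBA A Q) :
    MeasurableSet {x : (ℕ → A) × (ℕ → Q) | U.IsAcceptingRun x.1 x.2} := by
  have hstep : ∀ i : ℕ, MeasurableSet
      {x : (ℕ → A) × (ℕ → Q) | x.2 (i + 1) ∈ U.delta (x.2 i) (x.1 i)} := fun i => by
    have hm : Measurable fun x : (ℕ → A) × (ℕ → Q) => (x.2 (i + 1), x.2 i, x.1 i) := by fun_prop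
    exact hm (MeasurableSet.of_discrete (s := {y : Q × Q × A | y.1 ∈ U.delta y.2.1 y.2.2}))
  have hinit : MeasurableSet {x : (ℕ → A) × (ℕ → Q) | x.2 0 ∈ U.init} :=
    ((measurable_pi_apply 0).comp measurable_snd) (MeasurableSet.of_discrete (s := U.init))
  have hfin : MeasurableSet {x : (ℕ → A) × (ℕ → Q) | {i | x.2 i ∈ U.final}.Infinite} :=
    measurable_snd (measurableSet_infinite_preimage (MeasurableSet.of_discrete (s := U.final)))
  exact (hinit.inter (measurableSet_setOf_forall hstep)).inter hfin

/-- The set of words with an accepting run in `T` is the injective image of a Borel set. -/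
theorem Unambiguous.measurableSet_languageIn (hU : U.Unambiguous) {T : Set (ℕ → Q)}
    (hT : MeasurableSet T) : MeasurableSet (U.languageIn T) := by
  have himage : U.languageIn T =
      Prod.fst '' ({x : (ℕ → A) × (ℕ → Q) | U.IsAcceptingRun x.1 x.2} ∩ Prod.snd ⁻¹' T) := by
    ext w
    constructor
    · rintro ⟨ρ, h, hρ⟩
      exact ⟨(w, ρ), ⟨h, hρ⟩, rfl⟩
    · rintro ⟨⟨w', ρ⟩, ⟨h, hρ⟩, rfl⟩
      exact ⟨ρ, h, hρ⟩
  rw [himage]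
  refine (U.measurableSet_isAcceptingRun.inter (measurable_snd hT)).image_of_measurable_injOn
    measurable_fst ?_
  rintro ⟨w, ρ⟩ ⟨h, -⟩ ⟨w', ρ'⟩ ⟨h', -⟩ (rfl : w = w')
  exact Prod.ext rfl (hU w ρ ρ' h h')

theorem measurableSet_forall_ne (q : Q) : MeasurableSet {ρ : ℕ → Q | ∀ i, ρ i ≠ q} :=
  measurableSet_setOf_forall fun i =>
    (measurableSet_eq_fun (measurable_pi_apply i) measurable_const).compl

theorem measurableSet_infStates_eq_univ :
    MeasurableSet {ρ : ℕ → Q | infStates ρ = Set.univ} := by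
  have : {ρ : ℕ → Q | infStates ρ = Set.univ} =
      {ρ | ∀ q, {i | ρ i ∈ ({q} : Set Q)}.Infinite} := by
    ext ρ
    simp [infStates, Set.eq_univ_iff_forall]
  rw [this]
  exact measurableSet_setOf_forall fun q =>
    measurableSet_infinite_preimage (MeasurableSet.singleton q)

end Measurability

/-! ### Harmonic inequalities and null sets -/

section Probability

variable [Fintype A] [Nonempty A] [MeasurableSpace A] [DiscreteMeasurableSpace A]
  [Fintype Q] [MeasurableSpace Q] [DiscreteMeasurableSpace Q]

/-- The sets of words belonging to different transitions are disjoint: a common word would have two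
accepting runs from `p` differing at position 1, or two first letters. -/
theorem succSum_measureReal_language_le (hU : ∀ p, (U.startAt p).Unambiguous) (p : Q) :
    U.succSum (fun r => (wordMeasure A).real (U.startAt r).language) p ≤
      Fintype.card A * (wordMeasure A).real (U.startAt p).language := by
  classical
  have hmeas : ∀ r, MeasurableSet (U.startAt r).language := fun r => by
    rw [← languageIn_univ]
    exact (hU r).measurableSet_languageIn MeasurableSet.univ
  set s : Finset (A × Q) := Finset.univ.filter fun x => x.2 ∈ U.delta p x.1 with hs
  have hmem : ∀ x ∈ s, ∀ w ∈ consSet x.1 (U.startAt x.2).language,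
      ∃ ρ, (U.startAt p).IsAcceptingRun w ρ ∧ ρ 1 = x.2 := by
    rintro ⟨a, r⟩ hx w ⟨hw0, ρ, hρ⟩
    refine ⟨consWord p ρ, ?_, hρ.1.1⟩
    have := hρ.cons (Finset.mem_filter.1 hx).2
    rwa [← hw0, consWord_head_dropWord] at this
  have hdisj : Set.PairwiseDisjoint (s : Set (A × Q))
      fun x => consSet x.1 (U.startAt x.2).language := by
    intro x hx y hy hxy
    refine Set.disjoint_left.2 fun w hwx hwy => hxy ?_
    obtain ⟨ρ, hρ, h1⟩ := hmem x hx w hwx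
    obtain ⟨ρ', hρ', h1'⟩ := hmem y hy w hwy
    exact Prod.ext (hwx.1.symm.trans hwy.1) (by rw [← h1, ← h1', hU p w ρ ρ' hρ hρ'])
  have hsub : (⋃ x ∈ s, consSet x.1 (U.startAt x.2).language) ⊆ (U.startAt p).language := by
    refine Set.iUnion₂_subset fun x hx w hw => ?_
    obtain ⟨ρ, hρ, -⟩ := hmem x hx w hw
    exact ⟨ρ, hρ⟩
  calc U.succSum (fun r => (wordMeasure A).real (U.startAt r).language) p
      = ∑ x ∈ s, Fintype.card A *
          (wordMeasure A).real (consSet x.1 (U.startAt x.2).language) :=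
        Finset.sum_congr rfl fun x _ => (card_mul_measureReal_consSet x.1 (hmeas x.2)).symm
    _ = Fintype.card A *
          (wordMeasure A).real (⋃ x ∈ s, consSet x.1 (U.startAt x.2).language) := by
        rw [← Finset.mul_sum, measureReal_biUnion_finset hdisj
          fun x _ => measurableSet_consSet x.1 (hmeas x.2)]
    _ ≤ _ := mul_le_mul_of_nonneg_left (measureReal_mono hsub) (Nat.cast_nonneg _)

theorem card_mul_measureReal_languageIn_le (hU : ∀ p, (U.startAt p).Unambiguous) (p q : Q) :
    Fintype.card A * (wordMeasure A).real ((U.startAt p).languageIn {ρ | ∀ i, ρ i ≠ q}) ≤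
      U.succSum (fun r =>
        (wordMeasure A).real ((U.startAt r).languageIn {ρ | ∀ i, ρ i ≠ q})) p := by
  classical
  set N : Q → Set (ℕ → A) := fun r => (U.startAt r).languageIn {ρ | ∀ i, ρ i ≠ q} with hN
  have hmeas : ∀ r, MeasurableSet (N r) := fun r =>
    (hU r).measurableSet_languageIn (measurableSet_forall_ne q)
  set s : Finset (A × Q) := Finset.univ.filter fun x => x.2 ∈ U.delta p x.1 with hs
  have hsub : N p ⊆ ⋃ x ∈ s, consSet x.1 (N x.2) := by
    rintro w ⟨ρ, hρ, hq⟩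
    have hp : ρ 0 = p := hρ.1.1
    refine Set.mem_iUnion₂.2 ⟨(w 0, ρ 1), Finset.mem_filter.2 ⟨Finset.mem_univ _, ?_⟩, rfl,
      dropWord 1 ρ, hρ.startAt_drop 1, fun i => hq (i + 1)⟩
    rw [← hp]
    exact hρ.1.2 0
  calc Fintype.card A * (wordMeasure A).real (N p)
      ≤ Fintype.card A * ∑ x ∈ s, (wordMeasure A).real (consSet x.1 (N x.2)) :=
        mul_le_mul_of_nonneg_left
          ((measureReal_mono hsub (measure_ne_top _ _)).trans (measureReal_biUnion_finset_le _ _)) (Nat.cast_nonneg _)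
    _ = U.succSum (fun r => (wordMeasure A).real (N r)) p := by
        rw [Finset.mul_sum]
        exact Finset.sum_congr rfl fun x _ => card_mul_measureReal_consSet x.1 (hmeas x.2)

/-- Almost no word has an accepting run from `p` that avoids the state `q`. -/
theorem wordMeasure_languageIn_forall_ne (hconn : U.StronglyConnected)
    (hU : ∀ p, (U.startAt p).Unambiguous) (p q : Q) :
    wordMeasure A ((U.startAt p).languageIn {ρ | ∀ i, ρ i ≠ q}) = 0 := by
  refine (measureReal_eq_zero_iff).1 ?_
  refine hconn.eq_zero_of_le_succSum
    (f := fun r => (wordMeasure A).real ((U.startAt r).languageIn {ρ | ∀ i, ρ i ≠ q}))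
    (k := Fintype.card A) (Nat.cast_pos.2 Fintype.card_pos) (fun _ => measureReal_nonneg)
    (fun r => measureReal_mono ?_) (fun r => card_mul_measureReal_languageIn_le hU r q)
    (succSum_measureReal_language_le hU) (q := q) ?_ p
  · rintro w ⟨ρ, hρ, -⟩
    exact ⟨ρ, hρ⟩
  · have : (U.startAt q).languageIn {ρ | ∀ i, ρ i ≠ q} = ∅ :=
      Set.eq_empty_of_forall_notMem fun w ⟨ρ, hρ, hq⟩ => hq 0 hρ.1.1
    simp [this]

theorem wordMeasure_language_diff_infStates (hU : U.Unambiguous) (hconn : U.StronglyConnected) :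
    wordMeasure A (U.language \ U.languageIn {ρ | infStates ρ = Set.univ}) = 0 := by
  -- An initial state is needed to transfer unambiguity to all states; without one the language is
  -- empty.
  by_cases hinit : U.init.Nonempty
  · obtain ⟨p₀, hp₀⟩ := hinit
    have hU' := hU.forall_startAt hconn hp₀
    have hsub : U.language \ U.languageIn {ρ | infStates ρ = Set.univ} ⊆
        ⋃ (n : ℕ) (p : Q) (q : Q),
          dropWord n ⁻¹' (U.startAt p).languageIn {ρ | ∀ i, ρ i ≠ q} := by
      rintro w ⟨⟨ρ, hρ⟩, hw⟩
      have hne : infStates ρ ≠ Set.univ := fun h => hw ⟨ρ, hρ, h⟩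
      obtain ⟨q, hq⟩ := (Set.ne_univ_iff_exists_notMem _).1 hne
      have hfin : {i | ρ i = q}.Finite := Set.not_infinite.1 hq
      obtain ⟨b, hb⟩ := hfin.bddAbove
      simp only [Set.mem_iUnion]
      -- All visits to `q` occur at positions at most `b`, so the tail from `b + 1` avoids `q`.
      refine ⟨b + 1, ρ (b + 1), q, dropWord (b + 1) ρ, hρ.startAt_drop (b + 1), fun i hi => ?_⟩
      have : i + (b + 1) ≤ b := hb hi
      omega
    refine measure_mono_null hsub (measure_iUnion_null fun n => measure_iUnion_null fun p =>
      measure_iUnion_null fun q => ?_)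
    exact wordMeasure_preimage_dropWord_eq_zero
      ((hU' p).measurableSet_languageIn (measurableSet_forall_ne q))
      (wordMeasure_languageIn_forall_ne hconn hU' p q) n
  · have : U.language = ∅ :=
      Set.eq_empty_of_forall_notMem fun w ⟨ρ, hρ⟩ => hinit ⟨ρ 0, hρ.1.1⟩
    simp [this]

end Probability

theorem Unambiguous.setOf_infStates_accRun (hU : U.Unambiguous) :
    {w : ℕ → A | ∃ hw : w ∈ U.language, infStates (U.accRun w hw) = Set.univ} =
      U.languageIn {ρ | infStates ρ = Set.univ} := by
  ext w
  constructor
  · rintro ⟨hw, h⟩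
    exact ⟨_, U.accRun_spec w hw, h⟩
  · rintro ⟨ρ, hρ, h⟩
    refine ⟨⟨ρ, hρ⟩, ?_⟩
    rw [← U.eq_accRun hU w ⟨ρ, hρ⟩ ρ hρ]
    exact h

end NBA

theorem mainTheorem10 {A Q : Type*} [Fintype A] [Nontrivial A] [MeasurableSpace A]
    [DiscreteMeasurableSpace A] [Finite Q] (U : NBA A Q) (hunamb : U.Unambiguous)
    (hconn : U.StronglyConnected) (hfinal : U.final.Nonempty) :
    MeasurableSet U.language ∧
    MeasurableSet {w : ℕ → A | ∃ hw : w ∈ U.language,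
      infStates (U.accRun w hw) = Set.univ} ∧
    wordMeasure A {w : ℕ → A | ∃ hw : w ∈ U.language,
      infStates (U.accRun w hw) = Set.univ} = wordMeasure A U.language := by
  let : MeasurableSpace Q := ⊤
  have : DiscreteMeasurableSpace Q := ⟨fun _ => trivial⟩
  have := Fintype.ofFinite Q
  rw [hunamb.setOf_infStates_accRun]
  refine ⟨?_, hunamb.measurableSet_languageIn NBA.measurableSet_infStates_eq_univ, ?_⟩
  · rw [← NBA.languageIn_univ]
    exact hunamb.measurableSet_languageIn MeasurableSet.univ
  · refine le_antisymm (measure_mono ?_) ?_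
    · rintro w ⟨ρ, hρ, -⟩
      exact ⟨ρ, hρ⟩
    · exact measure_mono_ae (ae_le_set.2
        (NBA.wordMeasure_language_diff_infStates hunamb hconn))
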